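/- Let $\gamma,\kappa\ge 2$ be integers with $\gamma\kappa>\gamma+\kappa$ (i.e. $(\gamma,\kappa)\ne(2,2)$), let $m\ge 0$ be the memory, $Z\ge 1$ the lifting degree and $N\ge 1$ the coupling length. A design is a pair $(\mathbf P,\mathbf L)$ of a partition matrix $\mathbf P\in\{0,\dots,m\}^{\gamma\times\kappa}$ and a lifting matrix $\mathbf L\in\{0,\dots,Z-1\}^{\gamma\times\kappa}$. It determines a QC-SC-LDPC parity-check matrix over the all-one $\gamma\times\kappa$ base matrix: for $0\le\ell\le m$ let $\mathbf H_\ell$ be the $0/1$ matrix with $\mathbf H_\ell(i,j)=1$ iff $\mathbf P(i,j)=\ell$; stack $\mathbf H_0,\dots,\mathbf H_m$ vertically into a replica, place $N$ copies of the replica side by side, the $t$-th one ($0\le t<N$) shifted down by $t$ block rows and all other blocks zero; then replace every $1$ coming from the base edge $(i,j)$ by $\sigma^{\mathbf L(i,j)}$, where $\sigma$ is the $Z\times Z$ one-step left cyclic shift of the identity, and every $0$ by the $Z\times Z$ zero matrix. A 4-cycle candidate consists of two distinct rows $i_1\neq i_2$ and two distinct columns $j_1\ne j_2$ of the base matrix;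 it is active if the Tanner graph of the parity-check matrix has a 4-cycle whose check nodes lie over $i_1,i_2$ and whose variable nodes lie over $j_1,j_2$. A design is 4-cycle-free if no 4-cycle candidate is active. Two designs are equivalent if one is obtained from the other by a permutation of the $\gamma$ rows and a permutation of the $\kappa$ columns, the same permutations being applied to $\mathbf P$ and to $\mathbf L$. Let $\#_N$ be the number of equivalence classes of 4-cycle-free designs. Put $\Delta=(2\gamma-3)(2\kappa-3)$, $$I=\frac{(\Delta-1)^{\Delta-1}}{\Delta^{\Delta}},\qquad II=\frac{27}{256(\gamma\kappa-\gamma-\kappa)} .$$ If $$\frac{2m^2+4m+3}{3(m+1)^3Z}\le\max\{I,II\},$$ then $$\#_N\ \ge\ \begin{cases}\dfrac{[Z(m+1)]^{\gamma\kappa}}{\gamma!\,\kappa!}\left(1-\dfrac{2}{\Delta}\right)^{\binom{\gamma}{2}\binom{\kappa}{2}},& \text{if } I>II,\\[3mm] \dfrac{[Z(m+1)]^{\gamma\kappa}}{\gamma!\,\kappa!}\left(1-\dfrac{\gamma\kappa-\gamma-\kappa+1}{4(\gamma\kappa-\gamma-\kappa)}\right)^{\gamma\kappa},& \text{if } I\le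 II.\end{cases}$$ -/

import Mathlib

open scoped Nat

namespace QCSC

/-- A design for a Type-I QC-SC-LDPC code built on the all-one `γ × κ` base matrix, with memory `m`
and lifting degree `Z`: every base edge `(i, j)` carries the pair `(P(i,j), L(i,j))` formed by an
entry of the partition matrix and an entry of the lifting matrix. -/
abbrev Design (γ κ m Z : ℕ) : Type := Matrix (Fin γ) (Fin κ) (Fin (m + 1) × ZMod Z)

/-- The partition (edge-spreading) matrix of a design. -/
def Design.partition {γ κ m Z : ℕ} (D : Design γ κ m Z) : Matrix (Fin γ) (Fin κ) (Fin (m + 1)) :=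
  fun i j => (D i j).1

/-- The lifting matrix of a design. -/
def Design.lifting {γ κ m Z : ℕ} (D : Design γ κ m Z) : Matrix (Fin γ) (Fin κ) (ZMod Z) :=
  fun i j => (D i j).2

/-- The component matrix `H_ℓ`: its entry at `(i, j)` is `1` exactly when the base edge `(i, j)` is
assigned to the component `ℓ`. It vanishes for `ℓ > m`. -/
def Design.component {γ κ m Z : ℕ} (D : Design γ κ m Z) (l : ℕ) :
    Matrix (Fin γ) (Fin κ) (ZMod 2) :=
  fun i j => if (D.partition i j : ℕ) = l then 1 else 0

/-- The coupled protograph matrix with coupling length `N`: the `t`-th replica, that is the stack of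
`H_0, …, H_m`, occupies the block column `t` and starts at the block row `t`. -/
def Design.coupled {γ κ m Z : ℕ} (D : Design γ κ m Z) (N : ℕ) :
    Matrix (Fin (N + m) × Fin γ) (Fin N × Fin κ) (ZMod 2) :=
  fun r c => if (c.1 : ℕ) ≤ (r.1 : ℕ) then D.component ((r.1 : ℕ) - (c.1 : ℕ)) r.2 c.2 else 0

/-- The `Z × Z` circulant permutation matrix obtained from the identity by a one-step left cyclic
shift: row `a` has its `1` in column `a - 1`. -/
def circulant (Z : ℕ) : Matrix (ZMod Z) (ZMod Z) (ZMod 2) :=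
  fun a b => if b = a - 1 then 1 else 0

/-- The parity-check matrix: each `1` of the coupled protograph matrix that comes from the base edge
`(i, j)` is replaced by the power `L(i,j) ∈ {0, …, Z - 1}` of the circulant, each `0` by the zero
matrix. -/
def Design.parityCheck {γ κ m Z : ℕ} [NeZero Z] (D : Design γ κ m Z) (N : ℕ) :
    Matrix ((Fin (N + m) × Fin γ) × ZMod Z) ((Fin N × Fin κ) × ZMod Z) (ZMod 2) :=
  fun r c => D.coupled N r.1 c.1 * (circulant Z ^ (D.lifting r.1.2 c.1.2).val) r.2 c.2

/-- The Tanner graph of a binary matrix: the check nodes are the rows, the variable nodes are the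
columns, and the edges are the nonzero entries. -/
def tannerGraph {R C : Type*} (M : Matrix R C (ZMod 2)) : SimpleGraph (R ⊕ C) where
  Adj
    | .inl r, .inr c => M r c = 1
    | .inr c, .inl r => M r c = 1
    | _, _ => False
  symm := ⟨by rintro (r | c) (r' | c') h <;> exact h⟩
  loopless := ⟨by rintro (r | c) h <;> exact h⟩

/-- A 4-cycle candidate `(j₁, i₁, j₂, i₂)` of the fully connected base graph. -/
structure FourCycle (γ κ : ℕ) where
  j₁ : Fin κ
  i₁ : Fin γ
  j₂ : Fin κ
  i₂ : Fin γ
  rows_ne : i₁ ≠ i₂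
  cols_ne : j₁ ≠ j₂

/-- A 4-cycle candidate is active for a design (and coupling length `N`) if, after edge spreading
and lifting, the Tanner graph contains a 4-cycle lying over it: check nodes `r₁, r₂` over the base
rows `i₁, i₂` and variable nodes `c₁, c₂` over the base columns `j₁, j₂`, with
`c₁ ~ r₁ ~ c₂ ~ r₂ ~ c₁`. -/
def FourCycle.IsActive {γ κ m Z : ℕ} [NeZero Z] (c : FourCycle γ κ) (D : Design γ κ m Z) (N : ℕ) :
    Prop :=
  ∃ (r₁ r₂ : (Fin (N + m) × Fin γ) × ZMod Z) (c₁ c₂ : (Fin N × Fin κ) × ZMod Z),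
    r₁.1.2 = c.i₁ ∧ r₂.1.2 = c.i₂ ∧ c₁.1.2 = c.j₁ ∧ c₂.1.2 = c.j₂ ∧
    (tannerGraph (D.parityCheck N)).Adj (.inr c₁) (.inl r₁) ∧
    (tannerGraph (D.parityCheck N)).Adj (.inl r₁) (.inr c₂) ∧
    (tannerGraph (D.parityCheck N)).Adj (.inr c₂) (.inl r₂) ∧
    (tannerGraph (D.parityCheck N)).Adj (.inl r₂) (.inr c₁)

/-- The feasible designs: no 4-cycle candidate is active. -/
def fourCycleFree (γ κ m Z N : ℕ) [NeZero Z] : Set (Design γ κ m Z) :=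
  {D | ∀ c : FourCycle γ κ, ¬ c.IsActive D N}

/-- Two matrices are equivalent if one arises from the other by permuting rows and columns: row `i`
of `M` is row `ν i` of `M'`, and column `j` of `M` is column `ρ j` of `M'`. Applied to designs, the
same permutations act on the partition matrix and on the lifting matrix. -/
def matrixEquiv (γ κ : ℕ) (α : Type*) : Setoid (Matrix (Fin γ) (Fin κ) α) where
  r M M' := ∃ (ν : Equiv.Perm (Fin γ)) (ρ : Equiv.Perm (Fin κ)), ∀ i j, M i j = M' (ν i) (ρ j)
  iseqv :=
    { refl := fun _ => ⟨1, 1, fun _ _ => rfl⟩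
      symm := by
        rintro M M' ⟨ν, ρ, h⟩
        exact ⟨ν.symm, ρ.symm, fun i j => by simp [h]⟩
      trans := by
        rintro M M' M'' ⟨ν, ρ, h⟩ ⟨ν', ρ', h'⟩
        exact ⟨ν.trans ν', ρ.trans ρ', fun i j => by simp [h, h']⟩ }

/-- The number of pairwise non-equivalent 4-cycle-free designs: the number of equivalence classes
of the set of feasible designs. -/
noncomputable def numNonequivalent (γ κ m Z N : ℕ) [NeZero Z] : ℕ :=
  Nat.card (Quotient ((matrixEquiv γ κ (Fin (m + 1) × ZMod Z)).comap
    (Subtype.val : fourCycleFree γ κ m Z N → Design γ κ m Z)))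

/-- `Δ = (2γ - 3)(2κ - 3)`. The truncated subtractions are exact, as only `γ, κ ≥ 2` occur. -/
def Delta (γ κ : ℕ) : ℕ := (2 * γ - 3) * (2 * κ - 3)

/-- `I = (Δ - 1)^(Δ - 1) / Δ^Δ`. -/
noncomputable def boundI (γ κ : ℕ) : ℝ :=
  ((Delta γ κ : ℝ) - 1) ^ (Delta γ κ - 1) / (Delta γ κ : ℝ) ^ Delta γ κ

/-- `II = 27 / (256 (γκ - γ - κ))`. -/
noncomputable def boundII (γ κ : ℕ) : ℝ :=
  27 / (256 * ((γ : ℝ) * κ - γ - κ))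

end QCSC

/-! Label the base edges independently and uniformly by pairs (partition value, lifting value). An
active candidate forces the alternating sum of its four labels to vanish in both coordinates
(`FourCycle.IsActive.balanced`), an event of probability at most `(2m² + 4m + 3) / (3(m+1)³Z)`
(`card_balanced_comp_le`). It depends on four edges only, hence is independent of the events of all
candidates sharing no edge with it.

Two local lemmas, written as inequalities between cardinalities, bound from below the number of
labellings avoiding all these events. The symmetric one (`avoidCount_ge_of_degree_le`) uses that a
candidate has at most `Δ - 1` neighbours; the clique one (`avoidCount_ge_of_clique`) uses that an
edge lies in at most `(γ-1)(κ-1)` candidates. The thresholds `I` and `II` are the maxima, over the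
weight `x`, of the probabilities these lemmas tolerate. An equivalence class has at most `γ! κ!`
members (`card_fourCycleFree_le`), whence the denominator. -/

namespace QCSC

open Finset

/-! ### Local lemmas in counting form -/

section LocalLemma

open scoped Classical

variable {ι V β : Type*} [Fintype ι] [DecidableEq ι] [Fintype V]

/-- Events determined by complementary sets of coordinates are independent under the uniform
distribution on `ι → V`. -/
theorem card_filter_and_mul_card (P Q : (ι → V) → Prop) (E : Finset ι)
    (hP : ∀ f g, (∀ i ∈ E, f i = g i) → P f → P g)
    (hQ : ∀ f g, (∀ i ∉ E, f i = g i) → Q f → Q g) :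
    #{f | P f ∧ Q f} * #(univ : Finset (ι → V)) = #{f | P f} * #{f | Q f} := by
  rw [← card_product, ← card_product]
  -- Exchanging the coordinates outside `E` between two points is an involution.
  refine card_bij' (fun z _ => (E.piecewise z.1 z.2, E.piecewise z.2 z.1))
    (fun z _ => (E.piecewise z.1 z.2, E.piecewise z.2 z.1)) ?_ ?_ ?_ ?_
  · rintro ⟨f, g⟩ h
    simp only [mem_product, mem_filter, mem_univ, true_and, and_true] at h ⊢
    exact ⟨hP f _ (fun i hi => by simp [hi]) h.1, hQ f _ (fun i hi => by simp [hi]) h.2⟩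
  · rintro ⟨f, g⟩ h
    simp only [mem_product, mem_filter, mem_univ, true_and, and_true] at h ⊢
    exact ⟨hP f _ (fun i hi => by simp [hi]) h.1, hQ g _ (fun i hi => by simp [hi]) h.2⟩
  · rintro ⟨f, g⟩ -
    ext i <;> by_cases hi : i ∈ E <;> simp [hi]
  · rintro ⟨f, g⟩ -
    ext i <;> by_cases hi : i ∈ E <;> simp [hi]

/-- The number of points of `ι → V` that avoid all events in `S`. -/
noncomputable def avoidCount (A : β → (ι → V) → Prop) (S : Finset β) : ℝ :=
  (#{f : ι → V | ∀ b ∈ S, ¬ A b f} : ℝ)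

/-- The number of points of `ι → V` that lie in the event `b` and avoid all events in `S`. -/
noncomputable def hitCount (A : β → (ι → V) → Prop) (b : β) (S : Finset β) : ℝ :=
  (#{f : ι → V | A b f ∧ ∀ c ∈ S, ¬ A c f} : ℝ)

theorem avoidCount_nonneg (A : β → (ι → V) → Prop) (S : Finset β) : 0 ≤ avoidCount A S :=
  Nat.cast_nonneg _

theorem hitCount_anti (A : β → (ι → V) → Prop) (b : β) {S T : Finset β} (h : S ⊆ T) :
    hitCount A b T ≤ hitCount A b S := by
  unfold hitCount
  gcongr with f

theorem avoidCount_empty (A : β → (ι → V) → Prop) :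
    avoidCount A ∅ = Fintype.card (ι → V) := by
  simp [avoidCount]

/-- Union bound: a point avoiding `S` either avoids `C` as well or hits some member of `C`. -/
theorem avoidCount_le_union (A : β → (ι → V) → Prop) (S C : Finset β) :
    avoidCount A S ≤ avoidCount A (S ∪ C) + ∑ b ∈ C, hitCount A b S := by
  unfold avoidCount hitCount
  rw [← Nat.cast_sum, ← Nat.cast_add, Nat.cast_le]
  refine le_trans (card_le_card (t := univ.filter (fun f : ι → V => ∀ b ∈ S ∪ C, ¬ A b f) ∪
    C.biUnion fun b => univ.filter fun f : ι → V => A b f ∧ ∀ c ∈ S, ¬ A c f) fun f hf => ?_)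
    ((card_union_le _ _).trans (Nat.add_le_add_left card_biUnion_le _))
  simp only [mem_filter, mem_univ, true_and, mem_union, mem_biUnion] at hf ⊢
  by_cases h : ∃ b ∈ C, A b f
  · obtain ⟨b, hb, hA⟩ := h
    exact Or.inr ⟨b, hb, hA, hf⟩
  · push Not at h
    exact Or.inl fun b hb => hb.elim (hf b) (h b)

variable {A : β → (ι → V) → Prop} {supp : β → Finset ι} {p : ℝ}

/-- An event is independent of the conjunction of events whose supports avoid its own support. -/
theorem hitCount_le (hA : ∀ b f g, (∀ i ∈ supp b, f i = g i) → A b f → A b g)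
    (hp : ∀ b, (#{f | A b f} : ℝ) ≤ p * Fintype.card (ι → V)) (b : β) (S : Finset β) :
    hitCount A b S ≤ p * avoidCount A {c ∈ S | Disjoint (supp b) (supp c)} := by
  rcases isEmpty_or_nonempty (ι → V) with hV | hV
  · simp [hitCount, avoidCount, univ_eq_empty]
  refine (hitCount_anti A b (filter_subset (fun c => Disjoint (supp b) (supp c)) S)).trans ?_
  have key := card_filter_and_mul_card (A b)
    (fun f => ∀ c ∈ S.filter (fun c => Disjoint (supp b) (supp c)), ¬ A c f) (supp b) (hA b) (by
      intro f g hfg hf c hc hcg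
      refine hf c hc (hA c g f (fun i hi => (hfg i fun hib => ?_).symm) hcg)
      exact disjoint_left.1 (mem_filter.1 hc).2 hib hi)
  have hpos : (0 : ℝ) < Fintype.card (ι → V) := by exact_mod_cast Fintype.card_pos
  have key' : hitCount A b {c ∈ S | Disjoint (supp b) (supp c)} * Fintype.card (ι → V) =
      (#{f | A b f} : ℝ) * avoidCount A {c ∈ S | Disjoint (supp b) (supp c)} := by
    unfold hitCount avoidCount
    rw [card_univ] at key
    rw [← Nat.cast_mul, ← Nat.cast_mul, Nat.cast_inj]
    convert key
  refine le_of_mul_le_mul_right ?_ hpos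
  rw [key']
  nlinarith [mul_le_mul_of_nonneg_right (hp b)
    (avoidCount_nonneg A {c ∈ S | Disjoint (supp b) (supp c)})]

/-- Inductive step of the symmetric Lovász local lemma. -/
theorem avoidCount_insert_ge {d : ℕ} {x : ℝ} (hx0 : 0 ≤ x) (hx1 : x ≤ 1)
    (hA : ∀ b f g, (∀ i ∈ supp b, f i = g i) → A b f → A b g)
    (hp : ∀ b, (#{f | A b f} : ℝ) ≤ p * Fintype.card (ι → V))
    (hd : ∀ b, ∀ S : Finset β, b ∉ S → #{c ∈ S | ¬ Disjoint (supp b) (supp c)} ≤ d)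
    (hpx : p ≤ x * (1 - x) ^ d) :
    ∀ (n : ℕ) (S : Finset β), #S = n → ∀ b, b ∉ S →
      (1 - x) * avoidCount A S ≤ avoidCount A (insert b S) := by
  intro n
  induction n using Nat.strong_induction_on with
  | _ n ih =>
  intro S hS b hb
  set R := S.filter (fun c => Disjoint (supp b) (supp c)) with hR
  set T := S.filter (fun c => ¬ Disjoint (supp b) (supp c)) with hT
  have hRT : R ∪ T = S := filter_union_filter_not_eq _ _
  have hdisj : Disjoint R T := disjoint_filter_filter_not _ _ _
  -- Restoring the neighbours of `b` one at a time costs a factor `1 - x` each; the induction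
  -- hypothesis applies because the next neighbour is still missing from `R ∪ U`.
  have hremove : ∀ U ⊆ T, (1 - x) ^ #U * avoidCount A R ≤ avoidCount A (R ∪ U) := by
    intro U
    induction U using Finset.induction_on with
    | empty => simp
    | insert c U hc ihU =>
      intro hU
      have hcT := hU (mem_insert_self c U)
      have hUT := (subset_insert c U).trans hU
      have hcR : c ∉ R ∪ U := by
        rw [mem_union]
        exact fun h => h.elim (fun h => disjoint_left.1 hdisj h hcT) hc
      have hlt : #(R ∪ U) < n := by
        rw [← hS]
        refine card_lt_card ⟨hRT ▸ union_subset_union_right hUT, fun h => hcR (h ?_)⟩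
        exact filter_subset _ _ hcT
      have h1 := ih _ hlt _ rfl c hcR
      rw [card_insert_of_notMem hc, pow_succ, union_insert]
      calc (1 - x) ^ #U * (1 - x) * avoidCount A R
          = (1 - x) * ((1 - x) ^ #U * avoidCount A R) := by ring
        _ ≤ (1 - x) * avoidCount A (R ∪ U) :=
          mul_le_mul_of_nonneg_left (ihU hUT) (by linarith)
        _ ≤ _ := h1
  have h2 := hremove T subset_rfl
  rw [hRT] at h2
  have h3 := hitCount_le hA hp b S
  have h4 := avoidCount_le_union A S {b}
  rw [sum_singleton, union_comm, ← insert_eq] at h4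
  have h5 : p * avoidCount A R ≤ x * avoidCount A S := by
    calc p * avoidCount A R ≤ x * (1 - x) ^ d * avoidCount A R :=
          mul_le_mul_of_nonneg_right hpx (avoidCount_nonneg _ _)
      _ ≤ x * (1 - x) ^ #T * avoidCount A R := by
          refine mul_le_mul_of_nonneg_right ?_ (avoidCount_nonneg _ _)
          refine mul_le_mul_of_nonneg_left ?_ hx0
          exact pow_le_pow_of_le_one (by linarith) (by linarith) (hd b S hb)
      _ = x * ((1 - x) ^ #T * avoidCount A R) := by ring
      _ ≤ _ := mul_le_mul_of_nonneg_left h2 hx0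
  linarith

/-- The symmetric Lovász local lemma, in the form of a lower bound on the number of points that
avoid all events. -/
theorem avoidCount_ge_of_degree_le {d : ℕ} {x : ℝ} (hx0 : 0 ≤ x) (hx1 : x ≤ 1)
    (hA : ∀ b f g, (∀ i ∈ supp b, f i = g i) → A b f → A b g)
    (hp : ∀ b, (#{f | A b f} : ℝ) ≤ p * Fintype.card (ι → V))
    (hd : ∀ b, ∀ S : Finset β, b ∉ S → #{c ∈ S | ¬ Disjoint (supp b) (supp c)} ≤ d)
    (hpx : p ≤ x * (1 - x) ^ d) (S : Finset β) :
    (1 - x) ^ #S * Fintype.card (ι → V) ≤ avoidCount A S := by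
  induction S using Finset.induction_on with
  | empty => simp [avoidCount_empty]
  | insert b S hb ih =>
    rw [card_insert_of_notMem hb, pow_succ]
    calc (1 - x) ^ #S * (1 - x) * Fintype.card (ι → V)
        = (1 - x) * ((1 - x) ^ #S * Fintype.card (ι → V)) := by ring
      _ ≤ (1 - x) * avoidCount A S := mul_le_mul_of_nonneg_left ih (by linarith)
      _ ≤ _ := avoidCount_insert_ge hx0 hx1 hA hp hd hpx _ S rfl b hb

/-- Inductive step of the clique local lemma: adding events whose supports share the coordinate `v`
to a set of events whose supports do not contain `v`. -/
theorem avoidCount_union_clique_ge {k q : ℕ} {x : ℝ} (hx0 : 0 ≤ x) (hx1 : q * x ≤ 1)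
    (hA : ∀ b f g, (∀ i ∈ supp b, f i = g i) → A b f → A b g)
    (hp : ∀ b, (#{f | A b f} : ℝ) ≤ p * Fintype.card (ι → V))
    (hk : ∀ b, #(supp b) = k + 1)
    (hq : ∀ v, ∀ C : Finset β, (∀ b ∈ C, v ∈ supp b) → #C ≤ q)
    (hpx : p ≤ x * (1 - (q - 1) * x) ^ k) :
    ∀ (n : ℕ) (S : Finset β), #S = n → ∀ (v : ι) (C : Finset β), (∀ b ∈ S, v ∉ supp b) →
      (∀ b ∈ C, v ∈ supp b) → (1 - #C * x) * avoidCount A S ≤ avoidCount A (S ∪ C) := by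
  intro n
  induction n using Nat.strong_induction_on with
  | _ n ih =>
  intro S hS v C hSv hCv
  have hy0 : 0 ≤ 1 - ((q : ℝ) - 1) * x := by linarith
  have hhit : ∀ b ∈ C, hitCount A b S ≤ x * avoidCount A S := by
    intro b hb
    have hvb := hCv b hb
    have hbS : b ∉ S := fun h => hSv b h hvb
    have hq1 : 1 ≤ q := by simpa using hq v {b} (by simpa using hvb)
    -- Dropping the events through one coordinate of `b` at a time costs a factor `1 - (q-1)x` per
    -- coordinate rather than one factor per neighbour.
    have hremove : ∀ E ⊆ supp b, (1 - ((q : ℝ) - 1) * x) ^ #E *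
        avoidCount A (S.filter fun c => Disjoint E (supp c)) ≤ avoidCount A S := by
      intro E
      induction E using Finset.induction_on with
      | empty => simp
      | insert u E hu ihE =>
        intro hE
        have hEb := (subset_insert u E).trans hE
        set R := S.filter (fun c => Disjoint E (supp c)) with hR
        have hRS : R ⊆ S := filter_subset _ _
        have hfil : S.filter (fun c => Disjoint (insert u E) (supp c)) =
            R.filter (fun c => u ∉ supp c) := by
          ext c
          simp only [hR, mem_filter, disjoint_insert_left]
          tauto
        have hstep : (1 - ((q : ℝ) - 1) * x) * avoidCount A (R.filter fun c => u ∉ supp c) ≤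
            avoidCount A R := by
          set C' := R.filter (fun c => u ∈ supp c) with hC'
          have hbC' : b ∉ C' := fun h => hbS (hRS (filter_subset _ _ h))
          -- The event `b` also contains `u` but is not in `S`, so it takes one of the `q` places.
          have hcard : #C' + 1 ≤ q := by
            rw [← card_insert_of_notMem hbC']
            refine hq u _ fun c hc => ?_
            rcases mem_insert.1 hc with rfl | hc
            · exact hE (mem_insert_self u E)
            · exact (mem_filter.1 hc).2
          have hun : R.filter (fun c => u ∉ supp c) ∪ C' = R := by
            rw [union_comm]
            exact filter_union_filter_not_eq _ _
          have hcard' : (#C' : ℝ) ≤ (q : ℝ) - 1 := by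
            have : ((#C' + 1 : ℕ) : ℝ) ≤ q := by exact_mod_cast hcard
            push_cast at this
            linarith
          -- If `C'` is empty nothing is dropped, and the set need not be smaller than `S`, so the
          -- induction hypothesis may be unavailable.
          rcases C'.eq_empty_or_nonempty with h0 | ⟨c, hc⟩
          · rw [h0, union_empty] at hun
            rw [hun]
            have : (1 : ℝ) ≤ q := by exact_mod_cast hq1
            nlinarith [avoidCount_nonneg A R, mul_nonneg (sub_nonneg.2 this) hx0]
          · have hlt : #(R.filter fun c => u ∉ supp c) < n := by
              rw [← hS]
              refine card_lt_card ⟨(filter_subset _ _).trans hRS, fun h => ?_⟩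
              have hc' := mem_filter.1 hc
              exact (mem_filter.1 (h (hRS hc'.1))).2 hc'.2
            have h1 := ih _ hlt _ rfl u C' (fun c hc => (mem_filter.1 hc).2)
              (fun c hc => (mem_filter.1 hc).2)
            rw [hun] at h1
            refine le_trans (mul_le_mul_of_nonneg_right ?_ (avoidCount_nonneg _ _)) h1
            nlinarith
        rw [card_insert_of_notMem hu, pow_succ, hfil, mul_assoc]
        exact (mul_le_mul_of_nonneg_left hstep (pow_nonneg hy0 _)).trans (ihE hEb)
    -- No event of `S` contains `v`, so only the other `k` coordinates of `b` have to be cleared.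
    have h2 := hremove ((supp b).erase v) (erase_subset _ _)
    have hfil : S.filter (fun c => Disjoint ((supp b).erase v) (supp c)) =
        S.filter (fun c => Disjoint (supp b) (supp c)) := by
      refine filter_congr fun c hc => ?_
      rw [← insert_erase hvb, disjoint_insert_left, erase_insert (notMem_erase v _)]
      exact ⟨fun h => ⟨hSv c hc, h⟩, fun h => h.2⟩
    rw [hfil, card_erase_of_mem hvb, hk, Nat.add_sub_cancel] at h2
    refine (hitCount_le hA hp b S).trans ?_
    refine (mul_le_mul_of_nonneg_right hpx (avoidCount_nonneg _ _)).trans ?_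
    rw [mul_assoc]
    exact mul_le_mul_of_nonneg_left h2 hx0
  have h3 := avoidCount_le_union A S C
  have h4 : ∑ b ∈ C, hitCount A b S ≤ #C * (x * avoidCount A S) := by
    rw [← nsmul_eq_mul]
    exact sum_le_card_nsmul _ _ _ hhit
  linarith

/-- The clique local lemma of Kolipaka, Szegedy and Xu for events in independent variables, with
equal weights: every event depends on `k + 1` variables and every variable affects at most `q`
events. -/
theorem avoidCount_ge_of_clique [Fintype β] {k q : ℕ} {x : ℝ} (hx0 : 0 ≤ x) (hx1 : q * x ≤ 1)
    (hA : ∀ b f g, (∀ i ∈ supp b, f i = g i) → A b f → A b g)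
    (hp : ∀ b, (#{f | A b f} : ℝ) ≤ p * Fintype.card (ι → V))
    (hk : ∀ b, #(supp b) = k + 1)
    (hq : ∀ v, ∀ C : Finset β, (∀ b ∈ C, v ∈ supp b) → #C ≤ q)
    (hpx : p ≤ x * (1 - (q - 1) * x) ^ k) :
    (1 - q * x) ^ Fintype.card ι * Fintype.card (ι → V) ≤ avoidCount A (univ : Finset β) := by
  -- Induction over coordinates instead of events: each new coordinate adds one clique, hence the
  -- exponent `Fintype.card ι`.
  have key : ∀ E : Finset ι, (1 - q * x) ^ #E * Fintype.card (ι → V) ≤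
      avoidCount A (univ.filter fun b => ¬ Disjoint E (supp b)) := by
    intro E
    induction E using Finset.induction_on with
    | empty => simp [avoidCount_empty]
    | insert v E hv ih =>
      set S := univ.filter (fun b => ¬ Disjoint E (supp b)) with hS
      set S' := univ.filter (fun b => ¬ Disjoint (insert v E) (supp b)) with hS'
      set R := S'.filter (fun b => v ∉ supp b) with hR
      set C := S'.filter (fun b => v ∈ supp b) with hC
      have hun : R ∪ C = S' := by
        rw [union_comm]
        exact filter_union_filter_not_eq _ _
      have hRS : R ⊆ S := by
        intro b
        simp only [hR, hS, hS', mem_filter, mem_univ, true_and, disjoint_insert_left]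
        tauto
      have h1 := avoidCount_union_clique_ge hx0 hx1 hA hp hk hq hpx _ R rfl v C
        (fun c hc => (mem_filter.1 hc).2) (fun c hc => (mem_filter.1 hc).2)
      rw [hun] at h1
      have h2 : avoidCount A S ≤ avoidCount A R := by
        unfold avoidCount
        gcongr with f
      have h3 : (#C : ℝ) ≤ q := by
        exact_mod_cast hq v C fun c hc => (mem_filter.1 hc).2
      rw [card_insert_of_notMem hv, pow_succ]
      calc (1 - q * x) ^ #E * (1 - q * x) * Fintype.card (ι → V)
          = (1 - q * x) * ((1 - q * x) ^ #E * Fintype.card (ι → V)) := by ring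
        _ ≤ (1 - q * x) * avoidCount A R :=
          mul_le_mul_of_nonneg_left (ih.trans h2) (by linarith)
        _ ≤ (1 - #C * x) * avoidCount A R :=
          mul_le_mul_of_nonneg_right (by nlinarith) (avoidCount_nonneg _ _)
        _ ≤ _ := h1
  have h := key univ
  have huniv : (univ.filter fun b => ¬ Disjoint (univ : Finset ι) (supp b)) = univ := by
    refine filter_true_of_mem fun b _ hdis => ?_
    have h0 : supp b = ∅ :=
      eq_empty_of_forall_notMem fun i hi => disjoint_left.1 hdis (mem_univ i) hi
    have := hk b
    simp [h0] at this
  rwa [huniv, card_univ] at h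

end LocalLemma

end QCSC

namespace QCSC

open Finset

section Counting

/-! ### Probability that four labels balance -/

open scoped Classical

/-- A condition on the restriction to an injectively embedded set of coordinates has the same
probability under the uniform distribution as the condition itself. -/
theorem card_filter_comp_mul_card {ι V τ : Type*} [Fintype ι] [DecidableEq ι] [Fintype V]
    [Fintype τ] [DecidableEq τ]
    (T : (τ → V) → Prop) {g : τ → ι} (hg : Function.Injective g) :
    #{f : ι → V | T (f ∘ g)} * #(univ : Finset (τ → V)) =
      #{h | T h} * #(univ : Finset (ι → V)) := by
  rw [← card_product, ← card_product]
  -- The restriction of the first point to the range of `g` is exchanged with the second point.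
  refine card_bij' (fun z _ => (z.1 ∘ g, Function.extend g z.2 z.1))
    (fun z _ => (Function.extend g z.1 z.2, z.2 ∘ g)) ?_ ?_ ?_ ?_
  · rintro ⟨f, h⟩ hz
    simpa using hz
  · rintro ⟨f, h⟩ hz
    simpa [Function.extend_comp hg] using hz
  · rintro ⟨f, h⟩ -
    refine Prod.ext ?_ (by simp [Function.extend_comp hg])
    funext i
    by_cases hi : ∃ a, g a = i
    · obtain ⟨a, rfl⟩ := hi
      simp [hg.extend_apply]
    · simp [Function.extend_apply' _ _ _ hi]
  · rintro ⟨f, h⟩ -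
    refine Prod.ext (by simp [Function.extend_comp hg]) ?_
    funext i
    by_cases hi : ∃ a, g a = i
    · obtain ⟨a, rfl⟩ := hi
      simp [hg.extend_apply]
    · simp [Function.extend_apply' _ _ _ hi]

/-- With truncated subtraction, `(a - b) + (b - a)` is `|a - b|`. Passing from `n` to `n + 1` adds
`n(n+1)` to the double sum. -/
theorem three_mul_sum_dist (n : ℕ) :
    3 * ∑ a ∈ range n, ∑ b ∈ range n, ((a - b) + (b - a)) + n = n ^ 3 := by
  have hlin : ∀ n : ℕ, 2 * ∑ a ∈ range n, (n - a) = n * (n + 1) := by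
    intro n
    have h := sum_range_reflect (fun i => i) (n + 1)
    have h' := sum_range_id_mul_two (n + 1)
    simp only [Nat.add_sub_cancel] at h h'
    rw [← h, sum_range_succ] at h'
    simp only [Nat.sub_self] at h'
    linarith
  induction n with
  | zero => simp
  | succ n ih =>
    have h1 : ∀ a ∈ range n, ∑ b ∈ range (n + 1), ((a - b) + (b - a)) =
        ∑ b ∈ range n, ((a - b) + (b - a)) + (n - a) := by
      intro a ha
      rw [sum_range_succ]
      have := mem_range.1 ha
      omega
    have h2 : ∑ b ∈ range (n + 1), ((n - b) + (b - n)) = ∑ b ∈ range n, (n - b) := by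
      rw [sum_range_succ]
      simp only [Nat.sub_self, add_zero]
      refine sum_congr rfl fun b hb => ?_
      have := mem_range.1 hb
      omega
    rw [sum_range_succ, sum_congr rfl h1, sum_add_distrib, h2]
    have := hlin n
    nlinarith

/-- The number of additive quadruples in `{0, …, n - 1}` is `n (2 n ^ 2 + 1) / 3`. -/
theorem three_mul_card_additive_quadruples_le (n : ℕ) :
    3 * #{x : (Fin n × Fin n) × (Fin n × Fin n) |
      (x.1.1 : ℕ) + x.2.2 = x.1.2 + x.2.1} ≤ n * (2 * n ^ 2 + 1) := by
  -- The pairs with a prescribed difference `δ` are determined by their minimum, which is less than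
  -- `n - |δ|`.
  have hfib : ∀ a b : Fin n, #{y : Fin n × Fin n | (a : ℕ) + y.2 = b + y.1} ≤
      n - ((a : ℕ) - b + (b - a)) := by
    intro a b
    conv_rhs => rw [← card_range (n - ((a : ℕ) - b + (b - a)))]
    refine card_le_card_of_injOn (fun y => min (y.1 : ℕ) y.2) ?_ ?_
    · rintro ⟨c, d⟩ h
      simp only [coe_filter, mem_univ, true_and, Set.mem_ofPred_eq, coe_range, Set.mem_Iio] at h ⊢
      omega
    · rintro ⟨c, d⟩ h ⟨c', d'⟩ h' he
      simp only [coe_filter, mem_univ, true_and, Set.mem_ofPred_eq] at h h' he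
      simp only [Prod.mk.injEq, Fin.ext_iff]
      omega
  have hle : #{x : (Fin n × Fin n) × (Fin n × Fin n) |
      (x.1.1 : ℕ) + x.2.2 = x.1.2 + x.2.1} ≤
      ∑ a ∈ range n, ∑ b ∈ range n, (n - ((a - b) + (b - a))) := by
    rw [card_filter, Fintype.sum_prod_type, Fintype.sum_prod_type,
      ← Fin.sum_univ_eq_sum_range (fun a => ∑ b ∈ range n, (n - ((a - b) + (b - a))))]
    refine sum_le_sum fun a _ => ?_
    rw [← Fin.sum_univ_eq_sum_range (fun b => n - (((a : ℕ) - b) + (b - a)))]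
    refine sum_le_sum fun b _ => ?_
    rw [← card_filter]
    exact hfib a b
  have hsum : ∑ a ∈ range n, ∑ b ∈ range n, (n - ((a - b) + (b - a))) +
      ∑ a ∈ range n, ∑ b ∈ range n, ((a - b) + (b - a)) = n ^ 3 := by
    rw [← sum_add_distrib]
    trans ∑ a ∈ range n, ∑ b ∈ range n, n
    · refine sum_congr rfl fun a ha => ?_
      rw [← sum_add_distrib]
      refine sum_congr rfl fun b hb => ?_
      have := mem_range.1 ha
      have := mem_range.1 hb
      omega
    · simp
      ring
  have h3 := three_mul_sum_dist n
  nlinarith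

/-- The condition on the labels `a, b, c, d` of the base edges
`(i₁, j₁), (i₁, j₂), (i₂, j₁), (i₂, j₂)` that makes the 4-cycle candidate close up. -/
def Balanced {m Z : ℕ} (a b c d : Fin (m + 1) × ZMod Z) : Prop :=
  (a.1 : ℕ) + d.1 = b.1 + c.1 ∧ a.2 + d.2 = b.2 + c.2

theorem Balanced.swap_rows {m Z : ℕ} {a b c d : Fin (m + 1) × ZMod Z} (h : Balanced a b c d) :
    Balanced c d a b :=
  ⟨by have := h.1; omega, by rw [add_comm, ← h.2, add_comm]⟩

theorem Balanced.swap_cols {m Z : ℕ} {a b c d : Fin (m + 1) × ZMod Z} (h : Balanced a b c d) :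
    Balanced b a d c :=
  ⟨h.1.symm, h.2.symm⟩

/-- The partition values form an additive quadruple, and three lifting values determine the fourth.
-/
theorem three_mul_card_balanced_le (m Z : ℕ) [NeZero Z] :
    3 * #{h : Fin 4 → Fin (m + 1) × ZMod Z | Balanced (h 0) (h 1) (h 2) (h 3)} ≤
      (m + 1) * (2 * (m + 1) ^ 2 + 1) * Z ^ 3 := by
  have h1 : #{h : Fin 4 → Fin (m + 1) × ZMod Z | Balanced (h 0) (h 1) (h 2) (h 3)} ≤
      #(({x : (Fin (m + 1) × Fin (m + 1)) × (Fin (m + 1) × Fin (m + 1)) |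
        (x.1.1 : ℕ) + x.2.2 = x.1.2 + x.2.1} : Finset _) ×ˢ
        (univ : Finset (ZMod Z × ZMod Z × ZMod Z))) := by
    refine card_le_card_of_injOn (fun h => ((((h 0).1, (h 1).1), ((h 2).1, (h 3).1)),
      ((h 0).2, (h 1).2, (h 2).2))) ?_ ?_
    · intro h hh
      simp only [coe_filter, mem_univ, true_and, Set.mem_ofPred_eq] at hh
      simpa using hh.1
    · intro h hh h' hh' he
      simp only [coe_filter, mem_univ, true_and, Set.mem_ofPred_eq] at hh hh'
      simp only [Prod.mk.injEq] at he
      obtain ⟨⟨⟨e0, e1⟩, e2, e3⟩, f0, f1, f2⟩ := he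
      have f3 : (h 3).2 = (h' 3).2 := by
        have a := hh.2
        have a' := hh'.2
        rw [f0, f1, f2, ← a'] at a
        exact add_left_cancel a
      funext i
      fin_cases i
      · exact Prod.ext e0 f0
      · exact Prod.ext e1 f1
      · exact Prod.ext e2 f2
      · exact Prod.ext e3 f3
  rw [card_product] at h1
  have h2 : #(univ : Finset (ZMod Z × ZMod Z × ZMod Z)) = Z ^ 3 := by
    simp [ZMod.card]
    ring
  rw [h2] at h1
  calc _ ≤ 3 * (_ * Z ^ 3) := Nat.mul_le_mul_left 3 h1
    _ = 3 * _ * Z ^ 3 := by ring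
    _ ≤ _ := Nat.mul_le_mul_right _ (three_mul_card_additive_quadruples_le (m + 1))

theorem card_balanced_comp_le {ι : Type*} [Fintype ι] [DecidableEq ι] (m Z : ℕ) [NeZero Z] {g : Fin 4 → ι}
    (hg : Function.Injective g) :
    (#{f : ι → Fin (m + 1) × ZMod Z |
        Balanced (f (g 0)) (f (g 1)) (f (g 2)) (f (g 3))} : ℝ) ≤
      (2 * (m : ℝ) ^ 2 + 4 * m + 3) / (3 * ((m : ℝ) + 1) ^ 3 * Z) *
        Fintype.card (ι → Fin (m + 1) × ZMod Z) := by
  have h1 := card_filter_comp_mul_card (V := Fin (m + 1) × ZMod Z)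
    (fun h : Fin 4 → Fin (m + 1) × ZMod Z => Balanced (h 0) (h 1) (h 2) (h 3)) hg
  simp only [Function.comp_apply] at h1
  have h2 := three_mul_card_balanced_le m Z
  have hV : #(univ : Finset (Fin 4 → Fin (m + 1) × ZMod Z)) = ((m + 1) * Z) ^ 4 := by
    simp [ZMod.card]
  rw [hV, card_univ (α := ι → Fin (m + 1) × ZMod Z)] at h1
  set a := #{f : ι → Fin (m + 1) × ZMod Z |
    Balanced (f (g 0)) (f (g 1)) (f (g 2)) (f (g 3))}
  set b := #{h : Fin 4 → Fin (m + 1) × ZMod Z | Balanced (h 0) (h 1) (h 2) (h 3)}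
  set W := Fintype.card (ι → Fin (m + 1) × ZMod Z)
  have h1' : (a : ℝ) * (((m : ℝ) + 1) * Z) ^ 4 = b * W := by exact_mod_cast h1
  have h2' : 3 * (b : ℝ) ≤ ((m : ℝ) + 1) * (2 * ((m : ℝ) + 1) ^ 2 + 1) * Z ^ 3 := by
    exact_mod_cast h2
  have hZ : (0 : ℝ) < Z := by exact_mod_cast NeZero.pos Z
  have hm : (0 : ℝ) < (m : ℝ) + 1 := by positivity
  rw [div_mul_eq_mul_div, le_div_iff₀ (by positivity)]
  refine le_of_mul_le_mul_right ?_ (by positivity : 0 < ((m : ℝ) + 1) * Z ^ 3)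
  calc (a : ℝ) * (3 * ((m : ℝ) + 1) ^ 3 * Z) * (((m : ℝ) + 1) * Z ^ 3)
      = 3 * ((a : ℝ) * (((m : ℝ) + 1) * Z) ^ 4) := by ring
    _ = 3 * (b : ℝ) * W := by rw [h1']; ring
    _ ≤ ((m : ℝ) + 1) * (2 * ((m : ℝ) + 1) ^ 2 + 1) * Z ^ 3 * W :=
        mul_le_mul_of_nonneg_right h2' (Nat.cast_nonneg _)
    _ = _ := by ring

end Counting

/-! ### From Tanner graph cycles to label equations -/

section Activity

theorem circulant_pow_apply (Z : ℕ) [NeZero Z] (k : ℕ) (a b : ZMod Z) :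
    (circulant Z ^ k) a b = if b = a - k then 1 else 0 := by
  induction k generalizing b with
  | zero => simp [Matrix.one_apply, eq_comm]
  | succ k ih =>
    rw [pow_succ, Matrix.mul_apply]
    simp only [ih, circulant, ite_mul, one_mul, zero_mul, sum_ite_eq', mem_univ, if_true]
    push_cast
    congr 1
    rw [sub_sub]

theorem Design.parityCheck_eq_one {γ κ m Z N : ℕ} [NeZero Z] (D : Design γ κ m Z)
    {r : (Fin (N + m) × Fin γ) × ZMod Z} {c : (Fin N × Fin κ) × ZMod Z}
    (h : D.parityCheck N r c = 1) :
    (c.1.1 : ℕ) + (D r.1.2 c.1.2).1 = r.1.1 ∧ c.2 + (D r.1.2 c.1.2).2 = r.2 := by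
  unfold Design.parityCheck Design.coupled Design.component at h
  rw [circulant_pow_apply, ZMod.natCast_zmod_val] at h
  split_ifs at h with h1 h2 h3 <;> simp at h
  unfold Design.partition at h2
  unfold Design.lifting at h3
  exact ⟨by omega, by rw [h3]; ring⟩

/-- Along an edge, the label is the row position minus the column position, both for replicas and
inside circulants; around the cycle these differences telescope. Only this implication is needed for
a lower bound, and it is uniform in `N`. -/
theorem FourCycle.IsActive.balanced {γ κ m Z N : ℕ} [NeZero Z] {c : FourCycle γ κ}
    {D : Design γ κ m Z} (h : c.IsActive D N) :
    Balanced (D c.i₁ c.j₁) (D c.i₁ c.j₂) (D c.i₂ c.j₁) (D c.i₂ c.j₂) := by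
  obtain ⟨r₁, r₂, c₁, c₂, hr₁, hr₂, hc₁, hc₂, h11, h12, h22, h21⟩ := h
  have e11 := D.parityCheck_eq_one (show D.parityCheck N r₁ c₁ = 1 from h11)
  have e12 := D.parityCheck_eq_one (show D.parityCheck N r₁ c₂ = 1 from h12)
  have e22 := D.parityCheck_eq_one (show D.parityCheck N r₂ c₂ = 1 from h22)
  have e21 := D.parityCheck_eq_one (show D.parityCheck N r₂ c₁ = 1 from h21)
  rw [hr₁, hc₁] at e11
  rw [hr₁, hc₂] at e12
  rw [hr₂, hc₂] at e22
  rw [hr₂, hc₁] at e21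
  exact ⟨by omega, by linear_combination e11.2 - e12.2 + e22.2 - e21.2⟩

end Activity

/-! ### Counting pairs that meet a given set -/

section Pairs

/-- The unordered pairs of distinct elements of `Fin n`. -/
abbrev Pair (n : ℕ) : Type := {s : Finset (Fin n) // #s = 2}

theorem card_pairs (n : ℕ) : Fintype.card (Pair n) = n.choose 2 := by
  simp [Pair]

theorem card_pair_not_disjoint_add (n : ℕ) (u : Finset (Fin n)) :
    #{s : Pair n | ¬ Disjoint u s.1} + (n - #u).choose 2 = n.choose 2 := by
  have h1 : #{s : Pair n | Disjoint u s.1} = (n - #u).choose 2 := by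
    have hu : n - #u = #uᶜ := by rw [card_compl, Fintype.card_fin]
    rw [hu, ← card_powersetCard]
    refine card_bij (fun s _ => s.1) ?_ (fun _ _ _ _ h => Subtype.ext h) ?_
    · intro s hs
      simp only [mem_filter, mem_univ, true_and] at hs
      exact mem_powersetCard.2 ⟨subset_compl_iff_disjoint_left.2 hs, s.2⟩
    · intro s hs
      obtain ⟨h, h'⟩ := mem_powersetCard.1 hs
      exact ⟨⟨s, h'⟩, by simpa using subset_compl_iff_disjoint_left.1 h, rfl⟩
  rw [← h1, ← card_pairs, ← card_univ, add_comm]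
  exact card_filter_add_card_filter_not _

theorem card_pair_meets_pair {n : ℕ} (hn : 2 ≤ n) (s : Pair n) :
    #{s' : Pair n | ¬ Disjoint s.1 s'.1} = 2 * n - 3 := by
  have h := card_pair_not_disjoint_add n s.1
  rw [s.2] at h
  obtain ⟨g, rfl⟩ := Nat.exists_eq_add_of_le' hn
  have e1 : (g + 2).choose 2 = (g + 1) + (g + 1).choose 2 := by
    rw [Nat.choose_succ_succ' (g + 1) 1, Nat.choose_one_right]
  have e2 : (g + 1).choose 2 = g + g.choose 2 := by
    rw [Nat.choose_succ_succ' g 1, Nat.choose_one_right]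
  simp only [Nat.add_sub_cancel] at h
  omega

theorem card_pair_mem {n : ℕ} (i : Fin n) : #{s : Pair n | i ∈ s.1} = n - 1 := by
  have h := card_pair_not_disjoint_add n {i}
  simp only [disjoint_singleton_left, not_not, card_singleton] at h
  obtain ⟨g, rfl⟩ : ∃ g, n = g + 1 := Nat.exists_eq_add_of_le' (Fin.pos i)
  have e2 : (g + 1).choose 2 = g + g.choose 2 := by
    rw [Nat.choose_succ_succ' g 1, Nat.choose_one_right]
  rw [Nat.add_sub_cancel] at h
  omega

end Pairs

/-! ### Dependencies among candidates, and equivalence classes -/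

section Designs

open scoped Classical

variable {γ κ m Z : ℕ}

/-- The base edges of the 4-cycle candidate on a pair of rows and a pair of columns. -/
def cycleSupport (b : Pair γ × Pair κ) : Finset (Fin γ × Fin κ) := b.1.1 ×ˢ b.2.1

/-- The event that the 4-cycle candidate on a pair of rows and a pair of columns closes up. -/
def cycleEvent (b : Pair γ × Pair κ) (f : Fin γ × Fin κ → Fin (m + 1) × ZMod Z) : Prop :=
  ∃ i₁ ∈ b.1.1, ∃ i₂ ∈ b.1.1, ∃ j₁ ∈ b.2.1, ∃ j₂ ∈ b.2.1, i₁ ≠ i₂ ∧ j₁ ≠ j₂ ∧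
    Balanced (f (i₁, j₁)) (f (i₁, j₂)) (f (i₂, j₁)) (f (i₂, j₂))

theorem card_cycleSupport (b : Pair γ × Pair κ) : #(cycleSupport b) = 3 + 1 := by
  rw [cycleSupport, card_product, b.1.2, b.2.2]

theorem cycleEvent_congr (b : Pair γ × Pair κ) (f g : Fin γ × Fin κ → Fin (m + 1) × ZMod Z)
    (h : ∀ e ∈ cycleSupport b, f e = g e) : cycleEvent b f → cycleEvent b g := by
  rintro ⟨i₁, hi₁, i₂, hi₂, j₁, hj₁, j₂, hj₂, hi, hj, hB⟩
  refine ⟨i₁, hi₁, i₂, hi₂, j₁, hj₁, j₂, hj₂, hi, hj, ?_⟩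
  rwa [← h _ (mk_mem_product hi₁ hj₁), ← h _ (mk_mem_product hi₁ hj₂),
    ← h _ (mk_mem_product hi₂ hj₁), ← h _ (mk_mem_product hi₂ hj₂)]

/-- The four orderings of the rows and columns give the same equation up to symmetry, so no union
bound factor is lost. -/
theorem card_cycleEvent_le [NeZero Z] (b : Pair γ × Pair κ) :
    (#{f : Fin γ × Fin κ → Fin (m + 1) × ZMod Z | cycleEvent b f} : ℝ) ≤
      (2 * (m : ℝ) ^ 2 + 4 * m + 3) / (3 * ((m : ℝ) + 1) ^ 3 * Z) *
        Fintype.card (Fin γ × Fin κ → Fin (m + 1) × ZMod Z) := by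
  obtain ⟨i₁, i₂, hi, hs⟩ := card_eq_two.1 b.1.2
  obtain ⟨j₁, j₂, hj, ht⟩ := card_eq_two.1 b.2.2
  have hg : Function.Injective ![(i₁, j₁), (i₁, j₂), (i₂, j₁), (i₂, j₂)] := by
    intro x y hxy
    fin_cases x <;> fin_cases y <;> simp_all [eq_comm]
  refine le_trans ?_ (card_balanced_comp_le m Z hg)
  rw [Nat.cast_le]
  refine card_le_card fun f hf => ?_
  simp only [mem_filter, mem_univ, true_and] at hf ⊢
  obtain ⟨i, hi', i', hi'', j, hj', j', hj'', hne, hne', hB⟩ := hf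
  rw [hs, mem_insert, mem_singleton] at hi' hi''
  rw [ht, mem_insert, mem_singleton] at hj' hj''
  change Balanced (f (i₁, j₁)) (f (i₁, j₂)) (f (i₂, j₁)) (f (i₂, j₂))
  rcases hi' with rfl | rfl <;> rcases hi'' with rfl | rfl <;>
    first
    | exact absurd rfl hne
    | (rcases hj' with rfl | rfl <;> rcases hj'' with rfl | rfl <;>
        first
        | exact absurd rfl hne'
        | exact hB
        | exact hB.swap_rows
        | exact hB.swap_cols
        | exact hB.swap_rows.swap_cols)

theorem not_disjoint_cycleSupport {b c : Pair γ × Pair κ}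
    (h : ¬ Disjoint (cycleSupport b) (cycleSupport c)) :
    ¬ Disjoint b.1.1 c.1.1 ∧ ¬ Disjoint b.2.1 c.2.1 := by
  obtain ⟨⟨i, j⟩, h1, h2⟩ := not_disjoint_iff.1 h
  rw [cycleSupport, mem_product] at h1 h2
  exact ⟨not_disjoint_iff.2 ⟨i, h1.1, h2.1⟩, not_disjoint_iff.2 ⟨j, h1.2, h2.2⟩⟩

/-- Sharing an edge means that both the row pairs and the column pairs meet: `(2γ-3)(2κ-3)` choices,
one of which is `b` itself. -/
theorem card_neighbours_le (hγ : 2 ≤ γ) (hκ : 2 ≤ κ) (b : Pair γ × Pair κ)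
    (S : Finset (Pair γ × Pair κ)) (hb : b ∉ S) :
    #{c ∈ S | ¬ Disjoint (cycleSupport b) (cycleSupport c)} ≤ Delta γ κ - 1 := by
  have hsub : insert b {c ∈ S | ¬ Disjoint (cycleSupport b) (cycleSupport c)} ⊆
      ({s : Pair γ | ¬ Disjoint b.1.1 s.1} : Finset _) ×ˢ
        ({t : Pair κ | ¬ Disjoint b.2.1 t.1} : Finset _) := by
    intro c hc
    have hmeet : ¬ Disjoint (cycleSupport b) (cycleSupport c) := by
      rcases mem_insert.1 hc with rfl | hc
      · rw [disjoint_self_iff_empty, ← card_eq_zero, card_cycleSupport]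
        omega
      · exact (mem_filter.1 hc).2
    simpa [mem_product] using not_disjoint_cycleSupport hmeet
  have h := card_le_card hsub
  rw [card_insert_of_notMem fun h => hb (mem_filter.1 h).1, card_product,
    card_pair_meets_pair hγ, card_pair_meets_pair hκ] at h
  unfold Delta
  omega

theorem card_clique_le (e : Fin γ × Fin κ) (C : Finset (Pair γ × Pair κ))
    (hC : ∀ b ∈ C, e ∈ cycleSupport b) : #C ≤ (γ - 1) * (κ - 1) := by
  have hsub : C ⊆ ({s : Pair γ | e.1 ∈ s.1} : Finset _) ×ˢ
      ({t : Pair κ | e.2 ∈ t.1} : Finset _) := by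
    intro b hb
    have := mem_product.1 (hC b hb)
    simpa [mem_product] using this
  have h := card_le_card hsub
  rwa [card_product, card_pair_mem, card_pair_mem] at h

theorem avoidCount_cycleEvent_le [NeZero Z] (N : ℕ) :
    avoidCount (cycleEvent (m := m) (Z := Z)) (univ : Finset (Pair γ × Pair κ)) ≤
      (Nat.card (fourCycleFree γ κ m Z N) : ℝ) := by
  unfold avoidCount
  rw [Nat.cast_le, Nat.card_eq_fintype_card, ← Set.toFinset_card]
  refine card_le_card_of_injOn (fun f i j => f (i, j)) ?_ ?_
  · intro f hf
    simp only [coe_filter, mem_univ, true_and, Set.mem_ofPred_eq, forall_const] at hf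
    rw [Set.coe_toFinset]
    intro c hc
    refine hf (⟨{c.i₁, c.i₂}, Finset.card_pair c.rows_ne⟩, ⟨{c.j₁, c.j₂}, Finset.card_pair c.cols_ne⟩) ?_
    exact ⟨c.i₁, by simp, c.i₂, by simp, c.j₁, by simp, c.j₂, by simp, c.rows_ne, c.cols_ne,
      hc.balanced⟩
  · intro f _ g _ h
    funext ⟨i, j⟩
    exact congrFun (congrFun h i) j

/-- Every equivalence class contains at most `γ! κ!` designs. -/
theorem card_fourCycleFree_le [NeZero Z] (N : ℕ) :
    Nat.card (fourCycleFree γ κ m Z N) ≤ γ ! * κ ! * numNonequivalent γ κ m Z N := by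
  set s := (matrixEquiv γ κ (Fin (m + 1) × ZMod Z)).comap
    (Subtype.val : fourCycleFree γ κ m Z N → Design γ κ m Z)
  -- A design is recovered from its class and the permutations matching it with the chosen
  -- representative.
  have hrep : ∀ D : fourCycleFree γ κ m Z N, ∃ z : Equiv.Perm (Fin γ) × Equiv.Perm (Fin κ),
      ∀ i j, D.1 i j = (Quotient.out (Quotient.mk s D)).1 (z.1 i) (z.2 j) := by
    intro D
    obtain ⟨ν, ρ, h⟩ := Setoid.symm' s (Quotient.mk_out (s := s) D)
    exact ⟨(ν, ρ), h⟩
  choose z hz using hrep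
  have hinj : Function.Injective fun D : fourCycleFree γ κ m Z N => (z D, Quotient.mk s D) := by
    intro D D' h
    obtain ⟨h1, h2⟩ := Prod.mk.inj h
    refine Subtype.ext (Matrix.ext fun i j => ?_)
    rw [hz D, hz D', h1, h2]
  have h := Nat.card_le_card_of_injective _ hinj
  rw [Nat.card_prod, Nat.card_prod, Nat.card_perm, Nat.card_perm, Nat.card_fin, Nat.card_fin] at h
  exact h

end Designs

end QCSC

/-! ### Choice of weights and conclusion -/

open QCSC in
theorem corollary2 (γ κ m Z N : ℕ) [NeZero Z] (hγ : 2 ≤ γ) (hκ : 2 ≤ κ) (hγκ : γ + κ < γ * κ)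
    (hN : 1 ≤ N)
    (hcond : (2 * (m : ℝ) ^ 2 + 4 * m + 3) / (3 * ((m : ℝ) + 1) ^ 3 * Z) ≤
      max (QCSC.boundI γ κ) (QCSC.boundII γ κ)) :
    (QCSC.boundI γ κ > QCSC.boundII γ κ →
      ((Z : ℝ) * (m + 1)) ^ (γ * κ) *
          (1 - 2 / (QCSC.Delta γ κ : ℝ)) ^ (γ.choose 2 * κ.choose 2) / ((γ ! : ℝ) * (κ ! : ℝ)) ≤
        (QCSC.numNonequivalent γ κ m Z N : ℝ)) ∧
    (QCSC.boundI γ κ ≤ QCSC.boundII γ κ →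
      ((Z : ℝ) * (m + 1)) ^ (γ * κ) *
          (1 - ((γ : ℝ) * κ - γ - κ + 1) / (4 * ((γ : ℝ) * κ - γ - κ))) ^ (γ * κ) /
            ((γ ! : ℝ) * (κ ! : ℝ)) ≤
        (QCSC.numNonequivalent γ κ m Z N : ℝ)) := by
  have hcard : (Fintype.card (Fin γ × Fin κ → Fin (m + 1) × ZMod Z) : ℝ) =
      ((Z : ℝ) * (m + 1)) ^ (γ * κ) := by
    simp [ZMod.card, mul_comm]
  have hfin : ∀ w : ℝ, w ≤ avoidCount (cycleEvent (m := m) (Z := Z))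
      (Finset.univ : Finset (Pair γ × Pair κ)) →
      w / ((γ ! : ℝ) * (κ ! : ℝ)) ≤ (numNonequivalent γ κ m Z N : ℝ) := by
    intro w hw
    rw [div_le_iff₀ (by positivity), mul_comm]
    refine (hw.trans (avoidCount_cycleEvent_le N)).trans ?_
    exact_mod_cast card_fourCycleFree_le (γ := γ) (κ := κ) (m := m) (Z := Z) N
  constructor
  · intro hI
    rw [max_eq_left hI.le] at hcond
    refine hfin _ ?_
    have hΔ : 3 ≤ Delta γ κ := by
      unfold Delta
      rcases hγ.eq_or_lt with rfl | h
      · omega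
      · exact Nat.mul_le_mul (show 3 ≤ 2 * γ - 3 by omega) (show 1 ≤ 2 * κ - 3 by omega)
    have hΔ' : (3 : ℝ) ≤ Delta γ κ := by exact_mod_cast hΔ
    -- The weight `x = 1/Δ` maximizes `x(1-x)^(Δ-1)`, with maximum `I`.
    have hpx : (2 * (m : ℝ) ^ 2 + 4 * m + 3) / (3 * ((m : ℝ) + 1) ^ 3 * Z) ≤
        1 / (Delta γ κ : ℝ) * (1 - 1 / (Delta γ κ : ℝ)) ^ (Delta γ κ - 1) := by
      refine hcond.trans_eq ?_
      unfold boundI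
      have hne : (Delta γ κ : ℝ) ≠ 0 := by linarith
      rw [one_sub_div hne, div_pow, div_mul_div_comm, one_mul, ← pow_succ',
        Nat.sub_add_cancel (by omega)]
    have h := avoidCount_ge_of_degree_le (by positivity)
      (by rw [div_le_one] <;> linarith) cycleEvent_congr card_cycleEvent_le
      (card_neighbours_le hγ hκ) hpx Finset.univ
    refine le_trans ?_ h
    rw [hcard, Finset.card_univ, Fintype.card_prod, card_pairs, card_pairs, mul_comm]
    refine mul_le_mul_of_nonneg_right ?_ (by positivity)
    -- The local lemma gives the stronger base `1 - 1/Δ`; since `Δ ≥ 3`, the base `1 - 2/Δ` is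
    -- nonnegative and powers can be compared.
    refine pow_le_pow_left₀ ?_ ?_ _
    · rw [sub_nonneg, div_le_one] <;> linarith
    · gcongr
      norm_num
  · intro hII
    rw [max_eq_right hII] at hcond
    refine hfin _ ?_
    set d : ℝ := (γ : ℝ) * κ - γ - κ with hd
    have hd1 : 1 ≤ d := by
      have : ((γ + κ + 1 : ℕ) : ℝ) ≤ ((γ * κ : ℕ) : ℝ) := by exact_mod_cast hγκ
      push_cast at this
      linarith
    have hq : (((γ - 1) * (κ - 1) : ℕ) : ℝ) = d + 1 := by
      rw [Nat.cast_mul, Nat.cast_sub (by omega), Nat.cast_sub (by omega)]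
      push_cast
      ring
    have hd0 : d ≠ 0 := by linarith
    -- Here `k = 3` and `q - 1 = d`; the weight `x = 1/(4d)` maximizes `x(1-dx)³`, with maximum
    -- `27/(256d) = II`.
    have hpx : (2 * (m : ℝ) ^ 2 + 4 * m + 3) / (3 * ((m : ℝ) + 1) ^ 3 * Z) ≤
        1 / (4 * d) * (1 - ((((γ - 1) * (κ - 1) : ℕ) : ℝ) - 1) * (1 / (4 * d))) ^ 3 := by
      refine hcond.trans_eq ?_
      rw [hq, boundII, ← hd]
      field_simp
      ring
    have h := avoidCount_ge_of_clique (by positivity)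
      (by rw [hq, mul_one_div, div_le_one] <;> linarith) cycleEvent_congr card_cycleEvent_le
      card_cycleSupport card_clique_le hpx
    rw [hq, mul_one_div, hcard, Fintype.card_prod, Fintype.card_fin, Fintype.card_fin,
      mul_comm] at h
    exact h
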